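/- Let $p$ be a prime and let $R$ be a Noetherian reduced commutative ring of characteristic $p$. Let $R^\circ$ be the set of elements of $R$ lying in no minimal prime. For an $R$-module $M$ and $q=p^e$ let $\mathbb F^e(M)={}^eR\otimes_R M$, where ${}^eR$ is $R$ viewed as an $R$-algebra via the $e$-th iterate of Frobenius; put $z^q=1\otimes z$ for $z\in M$, and for a submodule $N\subseteq M$ let $N^{[q]}_M$ be the image of $\mathbb F^e(N)\to\mathbb F^e(M)$. For ideals $\mathfrak a,\mathfrak b$ meeting $R^\circ$ and real numbers $t,s>0$, let $N_M^{*\mathfrak a^t}$ (resp. $N_M^{*\mathfrak a^t\mathfrak b^s}$) be the submodule of all $z\in M$ for which there is $c\in R^\circ$ such that $c\,z^q\,\mathfrak a^{\lceil tq\rceil}\subseteq N^{[q]}_M$ (resp. $c\,z^q\,\mathfrak a^{\lceil tq\rceil}\mathfrak b^{\lceil sq\rceil}\subseteq N^{[q]}_M$) for all large $q=p^e$. For an ideal $I$ write $I^{*\mathfrak a^t}=I_R^{*\mathfrak a^t}$. Let $E=\bigoplus_{\mathfrak m}E_R(R/\mathfrak m)$ be the direct sum, over all maximal ideals, of the injective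 hulls of the residue fields, and put $$\widetilde\tau(\mathfrak a^t)=\operatorname{Ann}_R\bigl(0_E^{*\mathfrak a^t}\bigr),\qquad \tau(\mathfrak a^t)=\bigcap_{M}\operatorname{Ann}_R\bigl(0_M^{*\mathfrak a^t}\bigr),$$ where $M$ runs through all finitely generated submodules of $E$; define $\widetilde\tau(\mathfrak a^t\mathfrak b^s)$ and $\tau(\mathfrak a^t\mathfrak b^s)$ in the same way. (1) If $R$ is F-finite (that is, ${}^1R$ is a finitely generated $R$-module), then for all ideals $\mathfrak a,\mathfrak b$ of $R$ meeting $R^\circ$ and all real numbers $t,s>0$, $$\widetilde\tau(\mathfrak a^t)^{*\mathfrak a^t}\,\widetilde\tau(\mathfrak a^t\mathfrak b^s)\subseteq\widetilde\tau(\mathfrak a^t)\,\widetilde\tau(\mathfrak b^s).$$ (2) If $R$ is a complete local ring, then for all ideals $\mathfrak a,\mathfrak b$ of $R$ of positive height and all real numbers $t,s>0$, $$\tau(\mathfrak a^t)^{*\mathfrak a^t}\,\tau(\mathfrak a^t\mathfrak b^s)\subseteq\tau(\mathfrak a^t)\,\tau(\mathfrak b^s).$$ -/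

import Mathlib

open scoped TensorProduct DirectSum

universe u

namespace TestIdeal

section InjectiveHull

/-- `f : M → E` exhibits `E` as an injective hull of `M`: the module `E` is injective, and `f`
is an injective map whose image is essential, that is, meets every nonzero submodule of `E`
nontrivially. -/
structure IsInjectiveHull {R : Type u} [CommRing R] {M E : Type u} [AddCommGroup M] [Module R M]
    [AddCommGroup E] [Module R E] (f : M →ₗ[R] E) : Prop where
  injective_module : Module.Injective R E
  injective_map : Function.Injective f
  essential : ∀ N : Submodule R E, N ⊓ LinearMap.range f = ⊥ → N = ⊥

/-- Every module has an injective hull. -/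
theorem exists_isInjectiveHull (R : Type u) [CommRing R] (M : Type u) [AddCommGroup M]
    [Module R M] : ∃ (E : ModuleCat.{u} R) (f : M →ₗ[R] E), IsInjectiveHull f := by
  -- embed `M` into an injective module `I`
  let I : ModuleCat.{u} R := CategoryTheory.Injective.under (ModuleCat.of R M)
  let j : M →ₗ[R] I := (CategoryTheory.Injective.ι (ModuleCat.of R M)).hom
  have hj : Function.Injective j :=
    (ModuleCat.mono_iff_injective (CategoryTheory.Injective.ι (ModuleCat.of R M))).1 inferInstance
  have hI : Module.Injective R I := by
    have : CategoryTheory.Injective (ModuleCat.of R I) :=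
      inferInstanceAs (CategoryTheory.Injective
        (CategoryTheory.Injective.under (ModuleCat.of R M)))
    exact Module.injective_module_of_injective_object R I
  -- a maximal essential extension `N` of `M` inside `I`
  let S : Set (Submodule R I) := {N | LinearMap.range j ≤ N ∧
    ∀ K : Submodule R I, K ≤ N → K ⊓ LinearMap.range j = ⊥ → K = ⊥}
  have hS0 : LinearMap.range j ∈ S := by
    refine ⟨le_rfl, fun K hK h => ?_⟩
    rwa [inf_eq_left.2 hK] at h
  obtain ⟨N, -, hN⟩ := zorn_le_nonempty₀ S (by
    intro c hc hchain y hy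
    refine ⟨sSup c, ⟨(hc hy).1.trans (le_sSup hy), fun K hK h => ?_⟩, fun z hz => le_sSup hz⟩
    rw [eq_bot_iff]
    intro x hx
    obtain ⟨z, hz, hxz⟩ :=
      (Submodule.mem_sSup_of_directed ⟨y, hy⟩ hchain.directedOn).1 (hK hx)
    have h1 := (hc hz).2 (K ⊓ z) inf_le_right (by
      rw [eq_bot_iff, ← h]
      exact inf_le_inf_right _ inf_le_left)
    rw [← h1]
    exact ⟨hx, hxz⟩) _ hS0
  -- a maximal submodule `K` of `I` meeting `N` trivially
  obtain ⟨K, -, hK⟩ := zorn_le_nonempty₀ {K : Submodule R I | K ⊓ N = ⊥} (by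
    intro c hc hchain y hy
    refine ⟨sSup c, ?_, fun z hz => le_sSup hz⟩
    change _ = _
    rw [eq_bot_iff]
    rintro x ⟨hx, hxN⟩
    obtain ⟨z, hz, hxz⟩ := (Submodule.mem_sSup_of_directed ⟨y, hy⟩ hchain.directedOn).1 hx
    have h1 : z ⊓ N = ⊥ := hc hz
    rw [← h1]
    exact ⟨hxz, hxN⟩) ⊥ (by simp)
  have hKN : K ⊓ N = ⊥ := hK.prop
  have hmax : ∀ L : Submodule R I, K ≤ L → L ⊓ N = ⊥ → L ≤ K := fun L h1 h2 => hK.2 h2 h1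
  -- extend the inclusion of `N` to `I ⧸ K`
  have hqinj : Function.Injective (K.mkQ ∘ₗ N.subtype) := by
    rw [← LinearMap.ker_eq_bot, eq_bot_iff]
    intro n hn
    have h1 : (n : I) ∈ K := by simpa using hn
    have h2 : (n : I) ∈ K ⊓ N := ⟨h1, n.2⟩
    rw [hKN] at h2
    simpa using h2
  obtain ⟨h, hh⟩ := hI.out (K.mkQ ∘ₗ N.subtype) hqinj N.subtype
  let g : I →ₗ[R] I := h ∘ₗ K.mkQ
  have hg : ∀ n ∈ N, g n = n := fun n hn => hh ⟨n, hn⟩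
  have hgK : ∀ k ∈ K, g k = 0 := by
    intro k hk
    have : K.mkQ k = 0 := by simpa using hk
    simp [g, this]
  -- the image of this extension is again essential over `M`, hence equal to `N`
  have hrS : LinearMap.range g ∈ S := by
    refine ⟨fun x hx => ⟨x, hg x (hN.prop.1 hx)⟩, fun P hP hPj => ?_⟩
    have hPN : P ⊓ N = ⊥ := hN.prop.2 _ inf_le_right (by
      rw [eq_bot_iff, ← hPj]
      exact inf_le_inf_right _ inf_le_left)
    have h1 : P.comap g ≤ K := hmax _ (fun k hk => by simp [hgK k hk]) (by
      rw [eq_bot_iff, ← hPN]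
      rintro x ⟨hx, hxN⟩
      have : g x ∈ P := hx
      rw [hg x hxN] at this
      exact ⟨this, hxN⟩)
    rw [eq_bot_iff]
    intro x hx
    obtain ⟨y, rfl⟩ := hP hx
    simpa using hgK y (h1 hx)
  have hNr : LinearMap.range g ≤ N := hN.2 hrS (fun x hx => ⟨x, hg x hx⟩)
  have hr : ∀ x, g x ∈ N := fun x => hNr ⟨x, rfl⟩
  refine ⟨ModuleCat.of R N, j.codRestrict N (fun x => hN.prop.1 ⟨x, rfl⟩), ⟨⟨?_⟩, ?_, ?_⟩⟩
  · intro X Y _ _ _ _ f hf φ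
    obtain ⟨ψ, hψ⟩ := hI.out f hf (N.subtype ∘ₗ φ)
    refine ⟨(g.codRestrict N hr) ∘ₗ ψ, fun x => Subtype.ext ?_⟩
    have h1 : ψ (f x) = (φ x : I) := hψ x
    change g (ψ (f x)) = _
    rw [h1]
    exact hg _ (φ x).2
  · intro x y hxy
    exact hj (congrArg Subtype.val hxy)
  · intro P hP
    have h1 := hN.prop.2 (P.map N.subtype) (Submodule.map_subtype_le _ _) (by
      rw [eq_bot_iff]
      rintro _ ⟨⟨x, hx, rfl⟩, m, hm⟩
      have h2 : x ∈ P ⊓ LinearMap.range (j.codRestrict N (fun x => hN.prop.1 ⟨x, rfl⟩)) :=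
        ⟨hx, m, Subtype.ext hm⟩
      have h3 : x = 0 := by
        rw [hP] at h2
        exact (Submodule.mem_bot R).1 h2
      simp [h3])
    rw [eq_bot_iff]
    intro x hx
    have h2 : (x : I) ∈ P.map N.subtype := ⟨x, hx, rfl⟩
    rw [h1] at h2
    exact (Submodule.mem_bot R).2 (Subtype.ext ((Submodule.mem_bot R).1 h2))

/-- The injective hull `E_R(M)` of an `R`-module `M`. -/
noncomputable def InjectiveHull (R : Type u) [CommRing R] (M : Type u) [AddCommGroup M]
    [Module R M] : ModuleCat.{u} R :=
  (exists_isInjectiveHull R M).choose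

/-- The embedding `M → E_R(M)`. -/
noncomputable def InjectiveHull.ι (R : Type u) [CommRing R] (M : Type u) [AddCommGroup M]
    [Module R M] : M →ₗ[R] InjectiveHull R M :=
  (exists_isInjectiveHull R M).choose_spec.choose

theorem InjectiveHull.isInjectiveHull (R : Type u) [CommRing R] (M : Type u) [AddCommGroup M]
    [Module R M] : IsInjectiveHull (InjectiveHull.ι R M) :=
  (exists_isInjectiveHull R M).choose_spec.choose_spec

/-- `E = ⨁_𝔪 E_R(R/𝔪)`, the direct sum over all maximal ideals `𝔪` of `R` of the injective hulls
of the residue fields `R/𝔪`. -/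
abbrev ResidueHull (R : Type u) [CommRing R] : Type u :=
  ⨁ m : MaximalSpectrum R, InjectiveHull R (R ⧸ m.asIdeal)

end InjectiveHull

section TightClosure

/-- `R°`: the elements of `R` that lie in no minimal prime ideal. -/
def circ (R : Type u) [CommRing R] : Submonoid R where
  carrier := {x | ∀ P ∈ minimalPrimes R, x ∉ P}
  one_mem' := fun P hP h => hP.1.1.ne_top ((Ideal.eq_top_iff_one P).2 h)
  mul_mem' := fun hx hy P hP h => (hP.1.1.mem_or_mem h).elim (hx P hP) (hy P hP)

/-- The condition `𝔞 ∩ R° ≠ ∅`. -/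
def MeetsCirc {R : Type u} [CommRing R] (𝔞 : Ideal R) : Prop :=
  ((𝔞 : Set R) ∩ (circ R : Set R)).Nonempty

/-- `R` is F-finite: `R` is finitely generated as a module over itself via Frobenius. -/
def IsFFinite (p : ℕ) [Fact p.Prime] (R : Type u) [CommRing R] [CharP R p] : Prop :=
  (frobenius R p).Finite

/-- `ᵉR`: the ring `R`, viewed as an `R`-algebra via the iterated Frobenius `x ↦ x ^ (p ^ e)`. -/
@[nolint unusedArguments]
def FrobeniusTwist (_p _e : ℕ) (R : Type u) : Type u := R

instance (p e : ℕ) (R : Type u) [CommRing R] : CommRing (FrobeniusTwist p e R) :=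
  inferInstanceAs (CommRing R)

/-- The identity map `R → ᵉR` (an isomorphism of rings, not an `R`-linear map). -/
def FrobeniusTwist.of (p e : ℕ) (R : Type u) [CommRing R] : R ≃+* FrobeniusTwist p e R :=
  RingEquiv.refl R

noncomputable instance (p e : ℕ) [Fact p.Prime] (R : Type u) [CommRing R] [CharP R p] :
    Algebra R (FrobeniusTwist p e R) :=
  ((FrobeniusTwist.of p e R).toRingHom.comp (iterateFrobenius R p e)).toAlgebra

theorem FrobeniusTwist.algebraMap_apply (p e : ℕ) [Fact p.Prime] (R : Type u) [CommRing R]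
    [CharP R p] (r : R) :
    algebraMap R (FrobeniusTwist p e R) r = FrobeniusTwist.of p e R (r ^ p ^ e) :=
  rfl

variable (p : ℕ) [Fact p.Prime] {R : Type u} [CommRing R] [CharP R p]

/-- For `N ⊆ M` and `q = p ^ e`, this is `N^{[q]}_M`, the image of the map `𝔽ᵉ(N) → 𝔽ᵉ(M)` induced
by the inclusion, where `𝔽ᵉ(M) = ᵉR ⊗_R M`. It is a submodule for the action of `R` on the
factor `ᵉR`. -/
noncomputable def frobeniusPower {M : Type u} [AddCommGroup M] [Module R M] (N : Submodule R M)
    (e : ℕ) : Submodule (FrobeniusTwist p e R) (FrobeniusTwist p e R ⊗[R] M) :=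
  LinearMap.range (N.subtype.baseChange (FrobeniusTwist p e R))

/-- Given ideals `𝔠 e`, one for each `q = p ^ e`, the submodule of all `z ∈ M` for which there is
`c ∈ R°` with `c z^q 𝔠(e) ⊆ N^{[q]}_M` for all large `q = p ^ e`. Here `z^q = 1 ⊗ z` in
`𝔽ᵉ(M) = ᵉR ⊗_R M`, so that `c x z^q = (c x) ⊗ z`. -/
noncomputable def tightClosureAlong {M : Type u} [AddCommGroup M] [Module R M]
    (𝔠 : ℕ → Ideal R) (N : Submodule R M) : Submodule R M where
  carrier := {z | ∃ c ∈ circ R, ∀ᶠ e in Filter.atTop, ∀ x ∈ 𝔠 e,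
    FrobeniusTwist.of p e R (c * x) ⊗ₜ[R] z ∈ frobeniusPower p N e}
  zero_mem' := ⟨1, one_mem _, Filter.Eventually.of_forall fun e x _ => by
    rw [TensorProduct.tmul_zero]; exact zero_mem _⟩
  add_mem' := by
    rintro y z ⟨c, hc, hy⟩ ⟨d, hd, hz⟩
    refine ⟨c * d, mul_mem hc hd, ?_⟩
    filter_upwards [hy, hz] with e hy hz x hx
    rw [TensorProduct.tmul_add]
    refine add_mem ?_ ?_
    · have h := (frobeniusPower p N e).smul_mem (FrobeniusTwist.of p e R d) (hy x hx)
      rw [TensorProduct.smul_tmul', smul_eq_mul, ← map_mul] at h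
      rwa [show c * d * x = d * (c * x) by ring]
    · have h := (frobeniusPower p N e).smul_mem (FrobeniusTwist.of p e R c) (hz x hx)
      rw [TensorProduct.smul_tmul', smul_eq_mul, ← map_mul] at h
      rwa [show c * d * x = c * (d * x) by ring]
  smul_mem' := by
    rintro r z ⟨c, hc, hz⟩
    refine ⟨c, hc, ?_⟩
    filter_upwards [hz] with e hz x hx
    have h := (frobeniusPower p N e).smul_mem (algebraMap R (FrobeniusTwist p e R) r) (hz x hx)
    rwa [algebraMap_smul, ← TensorProduct.tmul_smul] at h

/-- The ideals `𝔞^⌈t q⌉`, `q = p ^ e`, attached to the formal power `𝔞^t`. -/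
noncomputable def realPower (𝔞 : Ideal R) (t : ℝ) (e : ℕ) : Ideal R :=
  𝔞 ^ ⌈t * (p : ℝ) ^ e⌉₊

/-- The ideals `𝔞^⌈t q⌉ 𝔟^⌈s q⌉`, `q = p ^ e`, attached to the formal product `𝔞^t 𝔟^s`. -/
noncomputable def realPowerMul (𝔞 : Ideal R) (t : ℝ) (𝔟 : Ideal R) (s : ℝ) (e : ℕ) : Ideal R :=
  realPower p 𝔞 t e * realPower p 𝔟 s e

/-- The `𝔞^t`-tight closure `I^{*𝔞^t}` of an ideal `I`, taken in `R`. -/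
noncomputable def idealTightClosure (I 𝔞 : Ideal R) (t : ℝ) : Ideal R :=
  tightClosureAlong p (M := R) (realPower p 𝔞 t) I

/-- `Ann_R(0_E^*)`, for the tight closure along the ideals `𝔠 e` and `E = ⨁_𝔪 E_R(R/𝔪)`. -/
noncomputable def tauTildeAlong (𝔠 : ℕ → Ideal R) : Ideal R :=
  (tightClosureAlong p 𝔠 (⊥ : Submodule R (ResidueHull R))).annihilator

/-- `⋂_M Ann_R(0_M^*)`, for the tight closure along the ideals `𝔠 e`, where `M` runs through the
finitely generated submodules of `E = ⨁_𝔪 E_R(R/𝔪)`. -/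
noncomputable def tauAlong (𝔠 : ℕ → Ideal R) : Ideal R :=
  ⨅ (M : Submodule R (ResidueHull R)) (_ : M.FG),
    (tightClosureAlong p 𝔠 (⊥ : Submodule R M)).annihilator

/-- The ideal `τ̃(𝔞^t)`. -/
noncomputable def tauTilde (𝔞 : Ideal R) (t : ℝ) : Ideal R :=
  tauTildeAlong p (realPower p 𝔞 t)

/-- The ideal `τ̃(𝔞^t 𝔟^s)`. -/
noncomputable def tauTildeMul (𝔞 : Ideal R) (t : ℝ) (𝔟 : Ideal R) (s : ℝ) : Ideal R :=
  tauTildeAlong p (realPowerMul p 𝔞 t 𝔟 s)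

/-- The ideal `τ(𝔞^t)`. -/
noncomputable def tau (𝔞 : Ideal R) (t : ℝ) : Ideal R :=
  tauAlong p (realPower p 𝔞 t)

/-- The ideal `τ(𝔞^t 𝔟^s)`. -/
noncomputable def tauMul (𝔞 : Ideal R) (t : ℝ) (𝔟 : Ideal R) (s : ℝ) : Ideal R :=
  tauAlong p (realPowerMul p 𝔞 t 𝔟 s)

end TightClosure

end TestIdeal

/-! Let `I` be the test ideal of `𝔞^t`, and let `J` be the product of `I` with the test ideal of
`𝔟^s`. Since `E` contains an injective hull of every residue field, an element of `R` lies in `J` as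
soon as it kills every `z ∈ E` with `J z = 0`. For such `z`, each `i z` with `i ∈ I` is killed by
the test ideal of `𝔟^s`. Suppose this forces `i z` into the `𝔟^s`-tight closure of zero. If `y ∈
I^{*𝔞^t}`, then `y^q` times a multiplier and `𝔞^⌈tq⌉` lands in `I^{[q]}`, while `I^{[q]} z^q` is
killed by a multiplier times `𝔟^⌈sq⌉`. Hence `y z` lies in the mixed tight closure of zero, which
the mixed test ideal kills.

The crux is therefore the double annihilator property: what the test ideal kills lies in the tight
closure of zero. In the complete local case, Matlis duality gives `Ann_E (Ann_R N) = N` for every `N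
⊆ E`; it is applied to the finitistic tight closure.

In the F-finite case this duality is unavailable. Instead `exists_uniform_multiplier` gives one `c₀
∈ R°` that is the value at any `d ∈ R°` of Cartier maps of arbitrarily high exponent. Such maps turn
an arbitrary multiplier `d` into `c₀`, so every `l (c₀ x)`, with `x ∈ 𝔠 e` and `l : ᵉR → R` linear,
lies in the test ideal. Since `ᵉR` is finite and `E` is a sum of injectives, these functionals
detect the vanishing of `c₀ x ⊗ z` (`tmul_eq_zero_of_residueHull`). -/

namespace TestIdeal

/-! ### Injective hulls of residue fields cogenerate. -/

section Cogenerator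

variable {R : Type u} [CommRing R]

/-- Over any module, a nonzero element whose annihilator lies in the maximal ideal `𝔪` survives in
some map to an injective hull of `R/𝔪`. -/
theorem IsInjectiveHull.exists_map_ne_zero {𝔪 : Ideal R} (h𝔪 : 𝔪 ≠ ⊤) {E : Type u}
    [AddCommGroup E] [Module R E] {f : (R ⧸ 𝔪) →ₗ[R] E} (hf : IsInjectiveHull f)
    {M : Type u} [AddCommGroup M] [Module R M] (x : M) (hx : ∀ r : R, r • x = 0 → r ∈ 𝔪) :
    ∃ g : M →ₗ[R] E, g x ≠ 0 := by
  let s : R →ₗ[R] M := LinearMap.toSpanSingleton R M x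
  have hle : LinearMap.ker s ≤ 𝔪 := fun r hr => hx r (by simpa [s] using hr)
  let φ : (R ⧸ LinearMap.ker s) →ₗ[R] E := f ∘ₗ Submodule.factor hle
  -- The cyclic module `R x` surjects onto `R/𝔪`; injectivity of `E` extends the resulting map `R x
  -- → E` to `M`.
  obtain ⟨g, hg⟩ := hf.injective_module.out ((LinearMap.ker s).liftQ s le_rfl)
    (LinearMap.ker_eq_bot.1 (Submodule.ker_liftQ_eq_bot _ _ _ le_rfl)) φ
  refine ⟨g, fun h0 => h𝔪 ?_⟩
  have h1 := hg ((LinearMap.ker s).mkQ 1)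
  have h2 : (LinearMap.ker s).liftQ s le_rfl ((LinearMap.ker s).mkQ 1) = x :=
    (Submodule.liftQ_apply _ _ _).trans (one_smul R x)
  rw [h2, h0] at h1
  have h3 : f (Submodule.Quotient.mk 1) = 0 := h1.symm
  have h4 : (Submodule.Quotient.mk 1 : R ⧸ 𝔪) = 0 := hf.injective_map (by rw [h3, map_zero])
  exact (Ideal.eq_top_iff_one _).2 ((Submodule.Quotient.mk_eq_zero _).1 h4)

/-- `E = ⨁ E_R(R/𝔪)` detects ideals: `Ann_R (Ann_E J) ⊆ J`. -/
theorem mem_of_forall_residueHull (J : Ideal R) (r : R)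
    (h : ∀ z : ResidueHull R, (∀ j ∈ J, j • z = 0) → r • z = 0) : r ∈ J := by
  classical
  by_contra hr
  let A : Ideal R := LinearMap.ker (LinearMap.toSpanSingleton R (R ⧸ J) (Submodule.Quotient.mk r))
  have hA : A ≠ ⊤ := by
    intro h1
    have h2 : (1 : R) ∈ A := h1 ▸ Submodule.mem_top
    have h3 : (Submodule.Quotient.mk r : R ⧸ J) = 0 := by simpa [A] using h2
    exact hr ((Submodule.Quotient.mk_eq_zero _).1 h3)
  obtain ⟨𝔪, h𝔪, hle⟩ := Ideal.exists_le_maximal A hA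
  obtain ⟨g, hg⟩ := (InjectiveHull.isInjectiveHull R (R ⧸ 𝔪)).exists_map_ne_zero h𝔪.ne_top
    (Submodule.Quotient.mk r : R ⧸ J) (fun s hs => hle (by simpa [A] using hs))
  let ι := DirectSum.lof R (MaximalSpectrum R)
    (fun m : MaximalSpectrum R => InjectiveHull R (R ⧸ m.asIdeal)) ⟨𝔪, h𝔪⟩
  have hmk : ∀ a b : R, a • (Submodule.Quotient.mk b : R ⧸ J) = Submodule.Quotient.mk (a * b) :=
    fun a b => rfl
  have h1 := h (ι (g (Submodule.Quotient.mk 1))) (fun j hj => by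
    rw [← map_smul, ← map_smul, hmk, mul_one, (Submodule.Quotient.mk_eq_zero _).2 hj, map_zero,
      map_zero])
  rw [← map_smul, ← map_smul, hmk, mul_one] at h1
  exact hg (DirectSum.of_injective (β := fun m : MaximalSpectrum R =>
    InjectiveHull R (R ⧸ m.asIdeal)) ⟨𝔪, h𝔪⟩ (h1.trans (map_zero _).symm))

end Cogenerator

/-! ### Detecting zero tensors by functionals. -/

section TensorDuality

variable {R : Type u} [CommRing R]

/-- For `M` finitely generated over a Noetherian ring and `E` injective, the map
`M ⊗ E → Hom(Hom(M, R), E)` is injective on pure tensors. -/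
theorem tmul_eq_zero_of_injective [IsNoetherianRing R] {M E : Type u} [AddCommGroup M]
    [Module R M] [Module.Finite R M] [AddCommGroup E] [Module R E] (hE : Module.Injective R E)
    (w : M) (z : E) (h : ∀ φ : M →ₗ[R] R, φ w • z = 0) : w ⊗ₜ[R] z = 0 := by
  classical
  obtain ⟨n, π, hπ⟩ := Module.Finite.exists_fin' R M
  obtain ⟨l, k, hk⟩ := Submodule.fg_iff_exists_fin_generating_family.1
    (IsNoetherian.noetherian (LinearMap.ker π))
  obtain ⟨v, rfl⟩ := hπ w
  -- `α` sends a functional on `Rⁿ` to its values on the generators of the relations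
  let α : (Fin n → R) →ₗ[R] (Fin l → R) := LinearMap.pi fun j =>
    ∑ i, k j i • LinearMap.proj i
  have hα : ∀ y j, α y j = ∑ i, k j i * y i := fun y j => by simp [α]
  let β : (Fin n → R) →ₗ[R] E :=
    (LinearMap.toSpanSingleton R E z) ∘ₗ ∑ i, v i • LinearMap.proj i
  have hβ : ∀ y, β y = (∑ i, v i * y i) • z := fun y => by simp [β, Finset.sum_smul]
  -- A vector in the kernel of `α`, the transpose of the relation matrix, is a functional on `Rⁿ`
  -- that descends to `M`, so `h` applies to it. Injectivity of `E` then factors `β` through `α`.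
  have hker : LinearMap.ker α ≤ LinearMap.ker β := by
    intro y hy
    let φ₀ : (Fin n → R) →ₗ[R] R := ∑ i, y i • LinearMap.proj i
    have hφ₀ : ∀ x, φ₀ x = ∑ i, y i * x i := fun x => by simp [φ₀]
    have h1 : LinearMap.ker π ≤ LinearMap.ker φ₀ := by
      rw [← hk, Submodule.span_le]
      rintro _ ⟨j, rfl⟩
      have := congrFun (LinearMap.mem_ker.1 hy) j
      rw [hα] at this
      change φ₀ (k j) = 0
      rw [hφ₀, ← this.trans (Pi.zero_apply j)]
      exact Finset.sum_congr rfl fun i _ => mul_comm _ _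
    let e : M →ₗ[R] R := ((LinearMap.ker π).liftQ φ₀ h1) ∘ₗ
      (π.quotKerEquivOfSurjective hπ).symm.toLinearMap
    have he : e (π v) = φ₀ v := by
      have : (π.quotKerEquivOfSurjective hπ).symm (π v) = (LinearMap.ker π).mkQ v := by
        rw [LinearEquiv.symm_apply_eq]; rfl
      simp only [e, LinearMap.comp_apply, LinearEquiv.coe_coe, this]
      simp
    have h2 := h e
    rw [he, hφ₀] at h2
    change β y = 0
    rw [hβ, ← h2]
    congr 1
    exact Finset.sum_congr rfl fun i _ => mul_comm _ _
  obtain ⟨g, hg⟩ := hE.out ((LinearMap.ker α).liftQ α le_rfl)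
    (LinearMap.ker_eq_bot.1 (Submodule.ker_liftQ_eq_bot _ _ _ le_rfl))
    ((LinearMap.ker α).liftQ β hker)
  have hgα : ∀ y, g (α y) = β y := fun y => by
    have := hg ((LinearMap.ker α).mkQ y)
    simpa using this
  have hgs : ∀ x, g x = ∑ j, x j • g (Pi.single j 1) := fun x => by
    conv_lhs => rw [pi_eq_sum_univ' x]
    simp [map_sum]
  -- The factorization writes the `v i • z` as combinations of the relation coefficients, so moving
  -- scalars across the tensor leaves only terms `π (k j) ⊗ _ = 0`.
  have hv : ∀ i, v i • z = ∑ j, k j i • g (Pi.single j 1) := fun i => by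
    have := hgα (Pi.single i 1)
    rw [hβ, hgs] at this
    simpa [hα, Pi.single_apply] using this.symm
  have hπs : ∀ x, π x = ∑ i, x i • π (Pi.single i 1) := fun x => by
    conv_lhs => rw [pi_eq_sum_univ' x]
    simp [map_sum]
  rw [hπs v, TensorProduct.sum_tmul]
  simp_rw [TensorProduct.smul_tmul, hv, TensorProduct.tmul_sum, ← TensorProduct.smul_tmul]
  rw [Finset.sum_comm]
  refine Finset.sum_eq_zero fun j _ => ?_
  rw [← TensorProduct.sum_tmul, ← hπs]
  have : π (k j) = 0 := by
    have : k j ∈ LinearMap.ker π := hk ▸ Submodule.subset_span ⟨j, rfl⟩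
    exact this
  rw [this, TensorProduct.zero_tmul]

/-- The same for `E = ⨁ E_R(R/𝔪)`. -/
theorem tmul_eq_zero_of_residueHull [IsNoetherianRing R] {M : Type u} [AddCommGroup M]
    [Module R M] [Module.Finite R M] (w : M) (z : ResidueHull R)
    (h : ∀ φ : M →ₗ[R] R, φ w • z = 0) : w ⊗ₜ[R] z = 0 := by
  classical
  have h1 : ∀ m : MaximalSpectrum R, w ⊗ₜ[R] z m = 0 := fun m =>
    tmul_eq_zero_of_injective
      (InjectiveHull.isInjectiveHull R (R ⧸ m.asIdeal)).injective_module w (z m)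
      (fun φ => by rw [← DirectSum.smul_apply, h φ]; rfl)
  rw [← DirectSum.sum_support_of z, TensorProduct.tmul_sum]
  refine Finset.sum_eq_zero fun m _ => ?_
  have h2 := congrArg (LinearMap.lTensor M (DirectSum.lof R (MaximalSpectrum R)
    (fun m : MaximalSpectrum R => InjectiveHull R (R ⧸ m.asIdeal)) m)) (h1 m)
  rw [map_zero, LinearMap.lTensor_tmul] at h2
  exact h2

theorem smul_eq_zero_of_tmul_eq_zero {M E : Type u} [AddCommGroup M]
    [Module R M] [AddCommGroup E] [Module R E] {w : M} {z : E} (h : w ⊗ₜ[R] z = 0)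
    (φ : M →ₗ[R] R) : φ w • z = 0 := by
  have := congrArg (fun t => TensorProduct.lid R E (LinearMap.rTensor E φ t)) h
  simpa using this

end TensorDuality

/-! ### Tight closure of zero and multiplication. -/

section TightClosure

variable (p : ℕ) [Fact p.Prime] {R : Type u} [CommRing R] [CharP R p]

theorem frobeniusPower_bot {M : Type u} [AddCommGroup M] [Module R M] (e : ℕ) :
    frobeniusPower p (⊥ : Submodule R M) e = ⊥ := by
  rw [frobeniusPower, Submodule.eq_bot_iff]
  rintro _ ⟨x, rfl⟩
  induction x with
  | zero => simp
  | tmul a b =>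
    have : (b : M) = 0 := (Submodule.mem_bot R).1 b.2
    simp [this]
  | add x y hx hy => rw [map_add, hx, hy, add_zero]

theorem mem_tightClosureAlong_bot {M : Type u} [AddCommGroup M] [Module R M]
    {𝔠 : ℕ → Ideal R} {z : M} : z ∈ tightClosureAlong p 𝔠 (⊥ : Submodule R M) ↔
      ∃ c ∈ circ R, ∀ᶠ e in Filter.atTop, ∀ x ∈ 𝔠 e,
        FrobeniusTwist.of p e R (c * x) ⊗ₜ[R] z = 0 := by
  change (∃ c ∈ circ R, _) ↔ _
  simp only [frobeniusPower_bot, Submodule.mem_bot]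

/-- Tight closures of zero are carried into each other by linear maps. -/
theorem map_mem_tightClosureAlong_bot {M N : Type u} [AddCommGroup M] [Module R M]
    [AddCommGroup N] [Module R N] (f : M →ₗ[R] N) {𝔠 : ℕ → Ideal R} {z : M}
    (hz : z ∈ tightClosureAlong p 𝔠 (⊥ : Submodule R M)) :
    f z ∈ tightClosureAlong p 𝔠 (⊥ : Submodule R N) := by
  rw [mem_tightClosureAlong_bot] at hz ⊢
  obtain ⟨c, hc, h⟩ := hz
  refine ⟨c, hc, h.mono fun e he x hx => ?_⟩
  have := congrArg (f.baseChange (FrobeniusTwist p e R)) (he x hx)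
  simpa using this

/-- If `I z ⊆ 0_M^{*𝔟}` and `y ∈ I^{*𝔞}`, then `y z ∈ 0_M^{*𝔞𝔟}`. -/
theorem smul_mem_tightClosureAlong_bot_mul {M : Type u} [AddCommGroup M] [Module R M]
    {𝔞 𝔟 : ℕ → Ideal R} {I : Ideal R} (hI : I.FG) {y : R} {z : M}
    (hy : y ∈ tightClosureAlong p (M := R) 𝔞 I)
    (hz : ∀ i ∈ I, i • z ∈ tightClosureAlong p 𝔟 (⊥ : Submodule R M)) :
    y • z ∈ tightClosureAlong p (fun e => 𝔞 e * 𝔟 e) (⊥ : Submodule R M) := by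
  classical
  -- a multiplier which works for all elements of `I`
  have key : ∃ d ∈ circ R, ∀ᶠ e in Filter.atTop, ∀ x ∈ 𝔟 e, ∀ i ∈ I,
      FrobeniusTwist.of p e R (d * x) ⊗ₜ[R] (i • z) = 0 := by
    obtain ⟨S, rfl⟩ := hI
    have h1 : ∀ i ∈ S, ∃ d ∈ circ R, ∀ᶠ e in Filter.atTop, ∀ x ∈ 𝔟 e,
        FrobeniusTwist.of p e R (d * x) ⊗ₜ[R] (i • z) = 0 := fun i hi =>
      (mem_tightClosureAlong_bot p).1 (hz i (Ideal.subset_span hi))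
    choose! d hd hde using h1
    refine ⟨∏ i ∈ S, d i, prod_mem hd, ?_⟩
    have h2 := (Filter.eventually_all_finset S).2 hde
    filter_upwards [h2] with e he x hx i hi
    induction hi using Submodule.span_induction with
    | mem i hi =>
      have h3 := congrArg (fun t => FrobeniusTwist.of p e R (∏ j ∈ S.erase i, d j) • t)
        (he i hi x hx)
      simp only [smul_zero] at h3
      rw [TensorProduct.smul_tmul', smul_eq_mul, ← map_mul, ← mul_assoc,
        Finset.prod_erase_mul S d hi] at h3
      exact h3
    | zero => rw [zero_smul, TensorProduct.tmul_zero]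
    | add a b _ _ ha hb => rw [add_smul, TensorProduct.tmul_add, ha, hb, add_zero]
    | smul r a _ ha => rw [smul_assoc, TensorProduct.tmul_smul, ha, smul_zero]
  obtain ⟨d, hd, hde⟩ := key
  obtain ⟨c, hc, hce⟩ := hy
  refine (mem_tightClosureAlong_bot p).2 ⟨c * d, mul_mem hc hd, ?_⟩
  filter_upwards [hde, hce] with e hde hce x hx
  refine Submodule.mul_induction_on hx (fun a ha b hb => ?_) (fun a b ha hb => ?_)
  · obtain ⟨t, ht⟩ := hce a ha
    -- The map `R → M`, `1 ↦ z`, carries `I^{[q]}` into the span of the `(i z)^q`, which `d * b`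
    -- kills.
    have h0 : ∀ t : FrobeniusTwist p e R ⊗[R] I, FrobeniusTwist.of p e R (d * b) •
        (LinearMap.toSpanSingleton R M z).baseChange (FrobeniusTwist p e R)
          (I.subtype.baseChange (FrobeniusTwist p e R) t) = 0 := by
      intro t
      induction t with
      | zero => simp
      | tmul w i =>
        rw [LinearMap.baseChange_tmul, LinearMap.baseChange_tmul, TensorProduct.smul_tmul',
          smul_eq_mul, mul_comm, ← smul_eq_mul, ← TensorProduct.smul_tmul']
        have := hde b hb i i.2
        simp only [Submodule.subtype_apply, LinearMap.toSpanSingleton_apply]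
        rw [this, smul_zero]
      | add s t hs ht => rw [map_add, map_add, smul_add, hs, ht, add_zero]
    have h1 := h0 t
    rw [ht, LinearMap.baseChange_tmul, TensorProduct.smul_tmul', smul_eq_mul, ← map_mul,
      LinearMap.toSpanSingleton_apply] at h1
    rwa [show c * d * (a * b) = d * b * (c * a) by ring]
  · rw [mul_add, map_add, TensorProduct.add_tmul, ha, hb, add_zero]

end TightClosure

end TestIdeal

namespace TestIdeal

/-! ### Matlis duality over a complete local ring. -/

section MatlisDuality

open IsLocalRing

theorem isFiniteLength_quotient_pow {R : Type u} [CommRing R] [IsLocalRing R]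
    [IsNoetherianRing R] (n : ℕ) : IsFiniteLength R (R ⧸ maximalIdeal R ^ n) := by
  rcases subsingleton_or_nontrivial (R ⧸ maximalIdeal R ^ n) with h | h
  · exact IsFiniteLength.of_subsingleton
  have := IsLocalRing.of_surjective' (Ideal.Quotient.mk (maximalIdeal R ^ n))
    Ideal.Quotient.mk_surjective
  have := IsLocalHom.of_surjective (Ideal.Quotient.mk (maximalIdeal R ^ n))
    Ideal.Quotient.mk_surjective
  have hmap : maximalIdeal (R ⧸ maximalIdeal R ^ n) ≤
      (maximalIdeal R).map (Ideal.Quotient.mk (maximalIdeal R ^ n)) := by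
    intro x hx
    obtain ⟨x, rfl⟩ := Ideal.Quotient.mk_surjective x
    exact Ideal.mem_map_of_mem _ (by simpa using hx)
  have hart : IsArtinianRing (R ⧸ maximalIdeal R ^ n) := by
    rw [isArtinianRing_iff_isNilpotent_maximalIdeal]
    refine ⟨n, eq_bot_iff.2 ((Ideal.pow_right_mono hmap n).trans ?_)⟩
    rw [← Ideal.map_pow, Ideal.map_quotient_self]
  exact isFiniteLength_iff_isNoetherian_isArtinian.2
    ⟨inferInstance, isArtinian_of_surjective_algebraMap (R := R ⧸ maximalIdeal R ^ n)
      (Ideal.Quotient.mk_surjective (I := maximalIdeal R ^ n))⟩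

variable {R : Type u} [CommRing R] [IsLocalRing R] {E : Type u} [AddCommGroup E] [Module R E]
  {f : (R ⧸ maximalIdeal R) →ₗ[R] E}

/-- The socle of `E_R(k)` is `k`. -/
theorem IsInjectiveHull.mem_range_of_smul_eq_zero (hf : IsInjectiveHull f) {x : E}
    (hx : ∀ a ∈ maximalIdeal R, a • x = 0) : x ∈ LinearMap.range f := by
  by_cases h0 : x = 0
  · exact h0 ▸ zero_mem _
  have h1 : Submodule.span R {x} ⊓ LinearMap.range f ≠ ⊥ := fun h =>
    h0 (Submodule.span_singleton_eq_bot.1 (hf.essential _ h))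
  obtain ⟨y, ⟨hy, hyf⟩, hy0⟩ := (Submodule.ne_bot_iff _).1 h1
  obtain ⟨r, rfl⟩ := Submodule.mem_span_singleton.1 hy
  have hr : IsUnit r := by
    by_contra h
    exact hy0 (hx r ((mem_maximalIdeal r).2 h))
  obtain ⟨u, rfl⟩ := hr
  have := (LinearMap.range f).smul_mem (↑u⁻¹ : R) hyf
  rwa [smul_smul, Units.inv_mul, one_smul] at this

/-- Every element of `E_R(k)` is killed by a power of the maximal ideal. -/
theorem IsInjectiveHull.exists_pow_smul_eq_zero [IsNoetherianRing R] (hf : IsInjectiveHull f)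
    (x : E) : ∃ n : ℕ, ∀ a ∈ maximalIdeal R ^ n, a • x = 0 := by
  let A : Ideal R := LinearMap.ker (LinearMap.toSpanSingleton R E x)
  have hA : ∀ r, r ∈ A ↔ r • x = 0 := fun r => by simp [A]
  have hrad : maximalIdeal R ≤ A.radical := by
    intro y hy
    let K : ℕ →o Ideal R := ⟨fun n => LinearMap.ker (LinearMap.toSpanSingleton R E (y ^ n • x)),
      monotone_nat_of_le_succ fun n r hr => by
        have : r • y ^ n • x = 0 := by simpa using hr
        have h2 : r • y ^ (n + 1) • x = y • r • y ^ n • x := by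
          simp only [smul_smul]; congr 1; ring
        simpa using h2.trans (by rw [this, smul_zero])⟩
    obtain ⟨n, hn⟩ := monotone_stabilizes_iff_noetherian.2 ‹IsNoetherianRing R› K
    have hn' := hn (n + 1) n.le_succ
    have hmem : ∀ k r, r ∈ K k ↔ r • y ^ k • x = 0 := fun k r => by simp [K]
    refine ⟨n, (hA _).2 ?_⟩
    by_contra h0
    have h1 : Submodule.span R {y ^ n • x} ⊓ LinearMap.range f ≠ ⊥ := fun h =>
      h0 (Submodule.span_singleton_eq_bot.1 (hf.essential _ h))
    obtain ⟨z, ⟨hz, t, ht⟩, hz0⟩ := (Submodule.ne_bot_iff _).1 h1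
    obtain ⟨r, rfl⟩ := Submodule.mem_span_singleton.1 hz
    -- A nonzero multiple `r y^n x` in the socle is killed by `y`, so `r` kills `y^(n+1) x`;
    -- stabilization of the annihilators makes `r` kill `y^n x`, a contradiction.
    refine hz0 ((hmem n r).1 (hn'.symm ▸ (hmem (n + 1) r).2 ?_))
    obtain ⟨t, rfl⟩ := Submodule.Quotient.mk_surjective _ t
    have h2 : r • y ^ (n + 1) • x = y • r • y ^ n • x := by
      simp only [smul_smul]; congr 1; ring
    rw [h2, ← ht, ← map_smul, ← Submodule.Quotient.mk_smul, smul_eq_mul,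
      (Submodule.Quotient.mk_eq_zero _).2 (Ideal.mul_mem_right _ _ hy), map_zero]
  obtain ⟨n, hn⟩ := Ideal.exists_pow_le_of_le_radical_of_fg hrad
    (IsNoetherian.noetherian (maximalIdeal R))
  exact ⟨n, fun a ha => (hA a).1 (hn ha)⟩

/-- `Hom(-, E_R(k))` does not increase length. -/
theorem IsInjectiveHull.length_hom_le (hf : IsInjectiveHull f) {M : Type u} [AddCommGroup M]
    [Module R M] (hM : IsFiniteLength R M) :
    Module.length R (M →ₗ[R] E) ≤ Module.length R M := by
  induction hM with
  | of_subsingleton => rw [Module.length_eq_zero]; exact bot_le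
  | @of_simple_quotient M _ _ N _ _ ih =>
    have hS : Module.length R ((M ⧸ N) →ₗ[R] E) ≤ 1 := by
      have := IsSimpleModule.nontrivial R (M ⧸ N)
      obtain ⟨s, hs⟩ := exists_ne (0 : M ⧸ N)
      have hspan : Submodule.span R {s} = ⊤ := (IsSimpleModule.span_singleton_eq_top R hs)
      have hkill : ∀ a ∈ maximalIdeal R, a • s = 0 := by
        intro a ha
        have hmax : Ideal.IsMaximal (LinearMap.ker (LinearMap.toSpanSingleton R (M ⧸ N) s)) :=
          IsSimpleModule.ker_toSpanSingleton_isMaximal R hs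
        rw [← eq_maximalIdeal hmax] at ha
        simpa using ha
      have hk : Module.length R (R ⧸ maximalIdeal R) = 1 := by
        have : IsSimpleModule R (R ⧸ maximalIdeal R) :=
          isSimpleModule_iff_quot_maximal.2 ⟨_, maximalIdeal.isMaximal R,
            ⟨LinearEquiv.refl _ _⟩⟩
        exact Module.length_eq_one R _
      let ev : ((M ⧸ N) →ₗ[R] E) →ₗ[R] LinearMap.range f :=
        (LinearMap.applyₗ s).codRestrict _ fun φ =>
          hf.mem_range_of_smul_eq_zero fun a ha => by
            rw [LinearMap.applyₗ_apply_apply, ← map_smul, hkill a ha, map_zero]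
      have hev : Function.Injective ev := by
        intro φ ψ h
        have h1 : φ s = ψ s := congrArg Subtype.val h
        exact LinearMap.ext_on_range (v := fun _ : Unit => s) (by simpa using hspan)
          fun _ => h1
      calc _ ≤ Module.length R (LinearMap.range f) := Module.length_le_of_injective ev hev
        _ ≤ Module.length R (R ⧸ maximalIdeal R) :=
          Module.length_le_of_surjective f.rangeRestrict f.surjective_rangeRestrict
        _ = 1 := hk
    let res : (M →ₗ[R] E) →ₗ[R] (N →ₗ[R] E) := LinearMap.lcomp R E N.subtype
    let pre : ((M ⧸ N) →ₗ[R] E) →ₗ[R] LinearMap.ker res :=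
      (LinearMap.lcomp R E N.mkQ).codRestrict _ fun φ => by
        rw [LinearMap.mem_ker]
        ext x
        have : (Submodule.Quotient.mk (x : M) : M ⧸ N) = 0 :=
          (Submodule.Quotient.mk_eq_zero _).2 x.2
        simp [res, this]
    have hpre : Function.Surjective pre := by
      rintro ⟨φ, hφ⟩
      have h1 : N ≤ LinearMap.ker φ := fun x hx =>
        LinearMap.congr_fun (LinearMap.mem_ker.1 hφ) ⟨x, hx⟩
      refine ⟨N.liftQ φ h1, Subtype.ext ?_⟩
      exact N.liftQ_mkQ φ h1
    rw [Module.length_eq_add_of_exact (LinearMap.ker res).subtype res.rangeRestrict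
        (Submodule.subtype_injective _) res.surjective_rangeRestrict
        (by rw [LinearMap.exact_iff]; simp),
      Module.length_eq_add_of_exact N.subtype N.mkQ N.subtype_injective N.mkQ_surjective
        (LinearMap.exact_subtype_mkQ N), Module.length_eq_one R (M ⧸ N), add_comm]
    exact add_le_add ((Module.length_le_of_injective _ (Submodule.subtype_injective _)).trans ih)
      ((Module.length_le_of_surjective pre hpre).trans hS)

/-- Over a local ring, `Ann_R (Ann_E I) ⊆ I` for `E = E_R(k)`. -/
theorem IsInjectiveHull.mem_of_forall_smul_eq_zero (hf : IsInjectiveHull f) {I : Ideal R} {r : R}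
    (h : ∀ x : E, (∀ a ∈ I, a • x = 0) → r • x = 0) : r ∈ I := by
  by_contra hrI
  have hmk : ∀ a b : R, a • (Submodule.Quotient.mk b : R ⧸ I) = Submodule.Quotient.mk (a * b) :=
    fun a b => rfl
  obtain ⟨g, hg⟩ := hf.exists_map_ne_zero (Ideal.IsPrime.ne_top')
    (Submodule.Quotient.mk r : R ⧸ I) (fun a ha => by
      by_contra h
      rw [mem_maximalIdeal, mem_nonunits_iff, not_not] at h
      rw [hmk, Submodule.Quotient.mk_eq_zero] at ha
      exact hrI ((Ideal.unit_mul_mem_iff_mem I h).1 ha))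
  refine hg ?_
  have h1 := h (g (Submodule.Quotient.mk 1)) fun a ha => by
    rw [← map_smul, hmk, mul_one, (Submodule.Quotient.mk_eq_zero _).2 ha, map_zero]
  rwa [← map_smul, hmk, mul_one] at h1

/-- On the elements killed by `𝔪ⁿ`, every endomorphism of `E_R(k)` is a homothety. -/
theorem IsInjectiveHull.exists_smul_of_pow [IsNoetherianRing R] (hf : IsInjectiveHull f)
    (φ : E →ₗ[R] E) (n : ℕ) :
    ∃ r : R, ∀ x : E, (∀ a ∈ maximalIdeal R ^ n, a • x = 0) → φ x = r • x := by
  let I := maximalIdeal R ^ n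
  let L : Submodule R E :=
    { carrier := {x | ∀ a ∈ I, a • x = 0}
      zero_mem' := fun a _ => smul_zero a
      add_mem' := fun hx hy a ha => by rw [smul_add, hx a ha, hy a ha, add_zero]
      smul_mem' := fun r x hx a ha => by rw [smul_comm, hx a ha, smul_zero] }
  have hQ : IsFiniteLength R (R ⧸ I) := isFiniteLength_quotient_pow n
  -- `L` embeds in `Hom(R/I, E)`
  have hLQ : Module.length R L ≤ Module.length R (R ⧸ I) := by
    refine le_trans ?_ (hf.length_hom_le hQ)
    have hle : ∀ x : L, I ≤ LinearMap.ker (LinearMap.toSpanSingleton R E x) := fun x a ha => by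
      simpa using x.2 a ha
    let j₀ : L → ((R ⧸ I) →ₗ[R] E) := fun x => Submodule.liftQ I _ (hle x)
    have hj₀ : ∀ x (a : R), j₀ x (Submodule.Quotient.mk a) = a • (x : E) := fun x a => rfl
    let j : L →ₗ[R] ((R ⧸ I) →ₗ[R] E) :=
      { toFun := j₀
        map_add' := fun x y => by
          refine Submodule.linearMap_qext _ (LinearMap.ext fun a => ?_)
          exact smul_add a (x : E) y
        map_smul' := fun r x => by
          refine Submodule.linearMap_qext _ (LinearMap.ext fun a => ?_)
          exact smul_comm a r (x : E) }
    refine Module.length_le_of_injective j fun x y h => Subtype.ext ?_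
    have : (1 : R) • (x : E) = (1 : R) • (y : E) :=
      LinearMap.congr_fun h (Submodule.Quotient.mk 1)
    simpa using this
  have hQtop : Module.length R (R ⧸ I) ≠ ⊤ := Module.length_ne_top_iff.2 hQ
  have hL : IsFiniteLength R L :=
    Module.length_ne_top_iff.1 (ne_top_of_le_ne_top hQtop hLQ)
  let μ : R →ₗ[R] (L →ₗ[R] E) := LinearMap.toSpanSingleton R _ L.subtype
  have hμ : LinearMap.ker μ ≤ I :=
    fun r hr => hf.mem_of_forall_smul_eq_zero fun x hx =>
      LinearMap.congr_fun (LinearMap.mem_ker.1 hr) ⟨x, hx⟩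
  -- Length count: `Hom(L, E)` is no longer than `L`, hence than `R/I`, while the image of `μ`
  -- surjects onto `R/I`.
  have hrange : LinearMap.range μ = ⊤ := by
    have hlen := (hf.length_hom_le hL).trans hLQ
    have hfin := isFiniteLength_iff_isNoetherian_isArtinian.1
      (Module.length_ne_top_iff.1 (ne_top_of_le_ne_top hQtop hlen))
    have := hfin.1
    have := hfin.2
    by_contra h
    have h1 := Submodule.length_lt h
    have h2 : Module.length R (R ⧸ I) ≤ Module.length R (LinearMap.range μ) :=
      (Module.length_le_of_surjective (Submodule.factor hμ) (Submodule.factor_surjective hμ)).trans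
        (μ.quotKerEquivRange.length_eq).le
    exact absurd (h1.trans_le (hlen.trans h2)) (lt_irrefl _)
  obtain ⟨r, hr⟩ := LinearMap.range_eq_top.1 hrange (φ ∘ₗ L.subtype)
  exact ⟨r, fun x hx => (LinearMap.congr_fun hr ⟨x, hx⟩).symm⟩

/-- Over a complete local ring, every endomorphism of `E_R(k)` is a homothety. -/
theorem IsInjectiveHull.exists_smul [IsNoetherianRing R] [IsAdicComplete (maximalIdeal R) R]
    (hf : IsInjectiveHull f) (φ : E →ₗ[R] E) : ∃ r : R, ∀ x, φ x = r • x := by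
  choose r hr using hf.exists_smul_of_pow φ
  have hcauchy : ∀ {m n : ℕ}, m ≤ n → r m - r n ∈ maximalIdeal R ^ m := by
    intro m n hmn
    refine hf.mem_of_forall_smul_eq_zero fun x hx => ?_
    rw [sub_smul, ← hr m x hx, ← hr n x fun a ha => hx a (Ideal.pow_le_pow_right hmn ha), sub_self]
  obtain ⟨s, hs⟩ := IsPrecomplete.prec' (I := maximalIdeal R) (M := R) r (fun {m n} hmn => by
    rw [SModEq.sub_mem]
    simpa using hcauchy hmn)
  refine ⟨s, fun x => ?_⟩
  obtain ⟨n, hn⟩ := hf.exists_pow_smul_eq_zero x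
  have h1 : r n - s ∈ maximalIdeal R ^ n := by
    have := hs n
    rw [SModEq.sub_mem] at this
    simpa using this
  rw [hr n x hn, ← sub_eq_zero, ← sub_smul]
  exact hn _ h1

/-- Over a complete local ring, `Ann_E (Ann_R N) = N` for all submodules `N ⊆ E = E_R(k)`. -/
theorem IsInjectiveHull.mem_of_annihilator [IsNoetherianRing R]
    [IsAdicComplete (maximalIdeal R) R] (hf : IsInjectiveHull f) (N : Submodule R E) {z : E}
    (hz : ∀ r ∈ N.annihilator, r • z = 0) : z ∈ N := by
  by_contra hzN
  obtain ⟨g, hg⟩ := hf.exists_map_ne_zero (Ideal.IsPrime.ne_top') (N.mkQ z) (fun a ha => by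
    by_contra h
    rw [mem_maximalIdeal, mem_nonunits_iff, not_not] at h
    obtain ⟨u, rfl⟩ := h
    rw [← map_smul, Submodule.mkQ_apply, Submodule.Quotient.mk_eq_zero] at ha
    have := N.smul_mem (↑u⁻¹ : R) ha
    rw [smul_smul, Units.inv_mul, one_smul] at this
    exact hzN this)
  -- An endomorphism that kills `N` but not `z` is a homothety, so its factor annihilates `N` and
  -- contradicts `hz`.
  obtain ⟨r, hr⟩ := hf.exists_smul (g ∘ₗ N.mkQ)
  have h1 : r ∈ N.annihilator := Submodule.mem_annihilator.2 fun n hn => by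
    rw [← hr n, LinearMap.comp_apply, Submodule.mkQ_apply, (Submodule.Quotient.mk_eq_zero _).2 hn,
      map_zero]
  exact hg ((hr z).trans (hz r h1))

/-- The same for `⨁ E_R(R/𝔪)`, which has a single summand. -/
theorem mem_of_annihilator_residueHull [IsNoetherianRing R] [IsAdicComplete (maximalIdeal R) R]
    (N : Submodule R (ResidueHull R)) {z : ResidueHull R}
    (hz : ∀ r ∈ N.annihilator, r • z = 0) : z ∈ N := by
  classical
  let m₀ : MaximalSpectrum R := ⟨maximalIdeal R, maximalIdeal.isMaximal R⟩
  have huniq : ∀ m : MaximalSpectrum R, m = m₀ := fun m =>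
    MaximalSpectrum.ext (eq_maximalIdeal m.isMaximal)
  let ι := DirectSum.lof R (MaximalSpectrum R)
    (fun m : MaximalSpectrum R => InjectiveHull R (R ⧸ m.asIdeal)) m₀
  have hι : ∀ x : ResidueHull R, ι (x m₀) = x := fun x => by
    refine DirectSum.ext_component R fun m => ?_
    rw [huniq m]
    exact DirectSum.component.lof_self _ _ _
  have key := (InjectiveHull.isInjectiveHull R (R ⧸ maximalIdeal R)).mem_of_annihilator
    (N.comap ι) (z := z m₀) (fun r hr => by
      have h1 : r ∈ N.annihilator := Submodule.mem_annihilator.2 fun n hn => by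
        have h2 := Submodule.mem_annihilator.1 hr (n m₀) (by
          rw [Submodule.mem_comap, hι]; exact hn)
        rw [← hι n, ← map_smul, h2, map_zero]
      have h3 := hz r h1
      rw [← DirectSum.smul_apply, h3]; rfl)
  rwa [Submodule.mem_comap, hι] at key

end MatlisDuality

end TestIdeal

namespace TestIdeal

/-! ### Multipliers and generic projectivity. -/

section Circ

variable {R : Type u} [CommRing R]

theorem eq_zero_of_mul_eq_zero_of_mem_circ [IsReduced R] {c x : R} (hc : c ∈ circ R)
    (h : c * x = 0) : x = 0 := by
  have h1 : x ∈ nilradical R := by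
    rw [nilradical, ← Ideal.sInf_minimalPrimes, Submodule.mem_sInf]
    intro Q hQ
    exact (hQ.1.1.mem_or_mem (h ▸ Q.zero_mem : c * x ∈ Q)).resolve_left (hc Q hQ)
  rwa [nilradical_eq_zero, Ideal.zero_eq_bot, Ideal.mem_bot] at h1

/-- Prime avoidance for the finitely many minimal primes. -/
theorem exists_mem_circ_of_not_le [IsNoetherianRing R] {I : Ideal R}
    (hI : ∀ Q ∈ minimalPrimes R, ¬ I ≤ Q) : ∃ c ∈ circ R, c ∈ I := by
  by_contra! h
  have h1 : (I : Set R) ⊆ ⋃ Q ∈ minimalPrimes R, (Q : Set R) := fun x hx => by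
    by_contra hx'
    simp only [Set.mem_iUnion, not_exists] at hx'
    exact h x (fun Q hQ hxQ => hx' Q hQ hxQ) hx
  obtain ⟨Q, hQ, hle⟩ := (Ideal.subset_union_prime_finite
    (minimalPrimes.finite_of_isNoetherianRing R)
    (f := fun Q : Ideal R => Q) ⊥ ⊥ fun Q hQ _ _ => hQ.1.1).1 h1
  exact hI Q hQ hle

/-- Generic projectivity: a finite module over a reduced Noetherian ring has, up to a multiplier
`c ∈ R°`, a dual basis. -/
theorem exists_smul_id_mem_span_smulRight [IsNoetherianRing R] [IsReduced R] (M : Type u)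
    [AddCommGroup M] [Module R M] [Module.Finite R M] :
    ∃ c ∈ circ R, c • LinearMap.id ∈ Submodule.span R
      (Set.range fun q : (M →ₗ[R] R) × M => q.1.smulRight q.2) := by
  classical
  let W := Submodule.span R (Set.range fun q : (M →ₗ[R] R) × M => q.1.smulRight q.2)
  have hmem : ∀ (φ : M →ₗ[R] R) (u : M), φ.smulRight u ∈ W := fun φ u =>
    Submodule.subset_span ⟨(φ, u), rfl⟩
  let D : Ideal R := W.comap (LinearMap.toSpanSingleton R (M →ₗ[R] M) LinearMap.id)
  suffices h : ∀ Q ∈ minimalPrimes R, ¬ D ≤ Q from exists_mem_circ_of_not_le h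
  intro Q hQ hDQ
  have hQp : Q.IsPrime := hQ.1.1
  let K := Localization.AtPrime Q
  let MQ := LocalizedModule Q.primeCompl M
  -- The localization of a reduced ring at a minimal prime is a field, so `M` becomes free there.
  -- Clearing denominators in a basis and its coordinates gives an element of `D` outside `Q`.
  have hK : IsField K := by
    have : Ring.KrullDimLE 0 K := .of_isLocalization _ hQ _
    exact Ring.KrullDimLE.isField_of_isReduced
  have hfree : Module.Free K MQ := by
    let := hK.toField
    exact Module.Free.of_divisionRing K MQ
  let ι := Module.Free.ChooseBasisIndex K MQ
  let b : Module.Basis ι K MQ := Module.Free.chooseBasis K MQ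
  let mk : M →ₗ[R] MQ := LocalizedModule.mkLinearMap Q.primeCompl M
  have := Module.finitePresentation_of_finite R M
  have hlift := fun i => Module.FinitePresentation.exists_lift_of_isLocalizedModule Q.primeCompl
    (Algebra.linearMap R K) (((b.coord i).restrictScalars R) ∘ₗ mk)
  choose φ s hφ using hlift
  have hu := fun i => IsLocalizedModule.surj Q.primeCompl mk (b i)
  choose u hu using hu
  let S : Q.primeCompl := ∏ i, (s i * (u i).2)
  let r : ι → R := fun i => (∏ j ∈ Finset.univ.erase i, (s j * (u j).2) : Q.primeCompl)
  have hr : ∀ i, (S : R) = r i * s i * (u i).2 := fun i => by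
    have := Finset.prod_erase_mul Finset.univ (fun j => s j * (u j).2) (Finset.mem_univ i)
    have := congrArg (fun t : Q.primeCompl => (t : R)) this
    simp only [S, r]
    rw [← this]
    simp only [Submonoid.coe_mul]
    ring
  let T : M →ₗ[R] M := ∑ i, r i • (φ i).smulRight (u i).1
  have hT : T ∈ W := Submodule.sum_mem _ fun i _ => W.smul_mem _ (hmem _ _)
  have hcomp : mk ∘ₗ ((S : R) • LinearMap.id) = mk ∘ₗ T := by
    ext x
    have h1 : mk x = ∑ i, b.repr (mk x) i • b i := (b.sum_repr _).symm
    simp only [LinearMap.comp_apply, LinearMap.smul_apply, LinearMap.id_apply, map_smul, T,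
      LinearMap.sum_apply, map_sum, LinearMap.smulRight_apply]
    conv_lhs => rw [h1, Finset.smul_sum]
    refine Finset.sum_congr rfl fun i _ => ?_
    have h2 : algebraMap R K (φ i x) = (s i : R) • b.repr (mk x) i := LinearMap.congr_fun (hφ i) x
    have h3 : ((u i).2 : R) • b i = mk (u i).1 := hu i
    rw [← h3, ← algebraMap_smul K (φ i x), h2, hr i]
    simp only [mul_smul, smul_assoc]
    rw [smul_comm ((u i).2 : R) (b.repr (mk x) i)]
  obtain ⟨t, ht⟩ := Module.Finite.exists_smul_of_comp_eq_of_isLocalizedModule Q.primeCompl mk _ _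
    hcomp
  have h1 : (t : R) * S ∈ D := by
    change ((t : R) * S) • LinearMap.id ∈ W
    rw [mul_smul]
    have : (t : R) • (S : R) • (LinearMap.id : M →ₗ[R] M) = (t : R) • T := ht
    rw [this]
    exact W.smul_mem _ hT
  exact (t * S).2 (hDQ h1)

end Circ

/-! ### Cartier maps and test elements in the F-finite case. -/

section Cartier

/-- A `p⁻ᵉ`-linear map `R → R`, that is, an `R`-linear map `ᵉR → R`. -/
def IsCartierMap (p e : ℕ) {R : Type u} [CommRing R] (φ : R →+ R) : Prop :=
  ∀ r x, φ (r ^ p ^ e * x) = r * φ x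

variable {p : ℕ} {R : Type u} [CommRing R]

theorem IsCartierMap.id : IsCartierMap p 0 (AddMonoidHom.id R) := fun r x => by simp

theorem IsCartierMap.comp {e e' : ℕ} {φ ψ : R →+ R} (hφ : IsCartierMap p e φ)
    (hψ : IsCartierMap p e' ψ) : IsCartierMap p (e + e') (φ.comp ψ) := fun r x => by
  rw [AddMonoidHom.comp_apply, pow_add, pow_mul, hψ, hφ, AddMonoidHom.comp_apply]

theorem IsCartierMap.comp_mulLeft {e : ℕ} {φ : R →+ R} (hφ : IsCartierMap p e φ) (a : R) :
    IsCartierMap p e (φ.comp (AddMonoidHom.mulLeft a)) := fun r x => by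
  simp only [AddMonoidHom.comp_apply, AddMonoidHom.coe_mulLeft]
  rw [mul_left_comm, hφ]

/-- The values at `d` of the `p⁻ᵉ`-linear maps. -/
def cartierImage (p e : ℕ) {R : Type u} [CommRing R] (d : R) : Ideal R where
  carrier := {r | ∃ φ : R →+ R, IsCartierMap p e φ ∧ φ d = r}
  zero_mem' := ⟨0, fun r x => by simp, rfl⟩
  add_mem' := by
    rintro _ _ ⟨φ, hφ, rfl⟩ ⟨ψ, hψ, rfl⟩
    exact ⟨φ + ψ, fun r x => by simp [hφ r x, hψ r x, mul_add], rfl⟩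
  smul_mem' := by
    rintro a _ ⟨φ, hφ, rfl⟩
    exact ⟨(AddMonoidHom.mulLeft a).comp φ, fun r x => by
      simp [hφ r x, mul_left_comm], rfl⟩

/-- Holds because `⌈t p^(e+k)⌉ ≤ ⌈t p^e⌉ p^k`. It lets a condition at exponent `e + k` be pulled
back to exponent `e` by a Cartier map. -/
theorem pow_mem_realPower (𝔞 : Ideal R) (t : ℝ) (e k : ℕ) :
    ∀ x ∈ realPower p 𝔞 t e, x ^ p ^ k ∈ realPower p 𝔞 t (e + k) := by
  intro x hx
  have h1 := Ideal.pow_mem_pow hx (p ^ k)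
  rw [realPower, ← pow_mul] at h1
  refine Ideal.pow_le_pow_right (Nat.ceil_le.2 ?_) h1
  push_cast
  rw [pow_add, ← mul_assoc]
  exact mul_le_mul_of_nonneg_right (Nat.le_ceil _) (by positivity)

variable [Fact p.Prime] [CharP R p]

theorem isCartierMap_of_linearMap {e : ℕ} (l : FrobeniusTwist p e R →ₗ[R] R) :
    IsCartierMap p e (l.toAddMonoidHom.comp (FrobeniusTwist.of p e R : R →+ FrobeniusTwist p e R))
    := fun r x => by
  have := l.map_smul r (FrobeniusTwist.of p e R x)
  rw [Algebra.smul_def, FrobeniusTwist.algebraMap_apply, ← map_mul] at this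
  exact this

theorem IsCartierMap.exists_linearMap {e : ℕ} {φ : R →+ R} (hφ : IsCartierMap p e φ) :
    ∃ l : FrobeniusTwist p e R →ₗ[R] R, ∀ x, l (FrobeniusTwist.of p e R x) = φ x :=
  ⟨{ toFun := fun x => φ ((FrobeniusTwist.of p e R).symm x)
     map_add' := fun x y => by rw [map_add, map_add]
     map_smul' := fun r x => hφ r x }, fun x => rfl⟩

theorem finite_frobeniusTwist (h : IsFFinite p R) (e : ℕ) :
    Module.Finite R (FrobeniusTwist p e R) := by
  have h1 : ∀ e, (iterateFrobenius R p e).Finite := by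
    intro e
    induction e with
    | zero => rw [iterateFrobenius_zero]; exact RingHom.Finite.id R
    | succ e ih =>
      have h2 : iterateFrobenius R p (e + 1) = (iterateFrobenius R p e).comp (frobenius R p) := by
        ext x; simp [iterateFrobenius_def, frobenius_def, pow_succ', pow_mul]
      rw [h2]
      exact ih.comp h
  have h2 : ((FrobeniusTwist.of p e R).toRingHom.comp (iterateFrobenius R p e)).Finite :=
    (RingHom.Finite.of_surjective _ (FrobeniusTwist.of p e R).surjective).comp (h1 e)
  exact h2

/-- Over an F-finite reduced ring, every `x` lies, up to multipliers, in the ideal generated by the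
`pᵉ`-th powers of the values at `x` of the `p⁻ᵉ`-linear maps. -/
theorem exists_pow_mul_mem_span [IsNoetherianRing R] [IsReduced R] (h : IsFFinite p R) :
    ∃ c ∈ circ R, ∀ e : ℕ, ∃ N : ℕ, ∀ x : R,
      c ^ N * x ∈ Ideal.span ((fun r => r ^ p ^ e) '' (cartierImage p e x : Set R)) := by
  have := finite_frobeniusTwist h 1
  obtain ⟨c, hc, hspan⟩ := exists_smul_id_mem_span_smulRight (R := R) (FrobeniusTwist p 1 R)
  -- In `¹R` the scalar `c` acts as `c ^ p`, and a dual basis expands `c • y` as a sum of terms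
  -- `l(y)^p u`.
  have h1 : ∀ y : R, c ^ p * y ∈
      Ideal.span ((fun r => r ^ p) '' (cartierImage p 1 y : Set R)) := by
    intro y
    let I := Ideal.span ((fun r => r ^ p) '' (cartierImage p 1 y : Set R))
    have hsm : ∀ (r : R) (w : FrobeniusTwist p 1 R), (FrobeniusTwist.of p 1 R).symm (r • w) =
        r ^ p * (FrobeniusTwist.of p 1 R).symm w := fun r w => by
      rw [Algebra.smul_def, FrobeniusTwist.algebraMap_apply, map_mul, RingEquiv.symm_apply_apply,
        pow_one]
    have h2 : ∀ T ∈ Submodule.span R (Set.range fun q : (FrobeniusTwist p 1 R →ₗ[R] R) ×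
        FrobeniusTwist p 1 R => q.1.smulRight q.2),
        (FrobeniusTwist.of p 1 R).symm (T (FrobeniusTwist.of p 1 R y)) ∈ I := by
      intro T hT
      induction hT using Submodule.span_induction with
      | mem T hT =>
        obtain ⟨⟨l, u⟩, rfl⟩ := hT
        rw [LinearMap.smulRight_apply, hsm]
        exact I.mul_mem_right _ (Ideal.subset_span ⟨_, ⟨_, isCartierMap_of_linearMap l, rfl⟩, rfl⟩)
      | zero => simp
      | add S T _ _ hS hT => rw [LinearMap.add_apply, map_add]; exact add_mem hS hT
      | smul r T _ hT => rw [LinearMap.smul_apply, hsm]; exact I.mul_mem_left _ hT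
    have h3 := h2 _ hspan
    rwa [LinearMap.smul_apply, hsm, LinearMap.id_apply, RingEquiv.symm_apply_apply] at h3
  refine ⟨c, hc, fun e => ?_⟩
  induction e with
  | zero => exact ⟨0, fun x => Ideal.subset_span
      ⟨x, ⟨AddMonoidHom.id R, IsCartierMap.id, rfl⟩, by simp⟩⟩
  | succ e ih =>
    obtain ⟨N, hN⟩ := ih
    refine ⟨p ^ (e + 1) + N, fun x => ?_⟩
    rw [pow_add c, mul_assoc]
    refine Submodule.span_induction (p := fun t _ => c ^ p ^ (e + 1) * t ∈ Ideal.span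
      ((fun r => r ^ p ^ (e + 1)) '' (cartierImage p (e + 1) x : Set R))) ?_ (by simp)
      (fun a b _ _ ha hb => by rw [mul_add]; exact add_mem ha hb)
      (fun r a _ ha => by rw [smul_eq_mul, mul_left_comm]; exact Ideal.mul_mem_left _ _ ha) (hN x)
    rintro _ ⟨_, ⟨φ, hφ, rfl⟩, rfl⟩
    have h2 := Ideal.mem_map_of_mem (iterateFrobenius R p e) (h1 (φ x))
    rw [iterateFrobenius_def, mul_pow, ← pow_mul, ← pow_succ', Ideal.map_span] at h2
    refine Ideal.span_mono ?_ h2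
    rintro _ ⟨_, ⟨_, ⟨ψ, hψ, rfl⟩, rfl⟩, rfl⟩
    refine ⟨_, ⟨ψ.comp φ, add_comm 1 e ▸ hψ.comp hφ, rfl⟩, ?_⟩
    simp [iterateFrobenius_def, ← pow_mul, pow_succ']

/-- Existence of test elements for F-finite reduced rings. -/
theorem exists_uniform_multiplier [IsNoetherianRing R] [IsReduced R] (h : IsFFinite p R) :
    ∃ c₀ ∈ circ R, ∀ d ∈ circ R, ∀ e₀ : ℕ, ∃ e ≥ e₀, ∃ φ : R →+ R, IsCartierMap p e φ ∧
      φ d = c₀ := by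
  obtain ⟨c, hc, hspan⟩ := exists_pow_mul_mem_span h
  have hp : 2 ≤ p := (Fact.out : p.Prime).two_le
  obtain ⟨n, φ₀, hφ₀, hφ₀1⟩ : ∃ n, c ^ n ∈ cartierImage p 1 (1 : R) := by
    obtain ⟨n, hn⟩ := hspan 1
    refine ⟨n, ?_⟩
    have h1 := hn 1
    rw [mul_one] at h1
    refine Ideal.span_le.2 ?_ h1
    rintro _ ⟨r, hr, rfl⟩
    exact Ideal.pow_mem_of_mem _ hr _ (by positivity)
  have hφ₀p : ∀ r, φ₀ (r ^ p) = r * c ^ n := fun r => by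
    have := hφ₀ r 1
    rwa [pow_one, mul_one, hφ₀1] at this
  -- a family of maps fixing `c ^ (2 * n)`
  have hψ : ∀ k : ℕ, ∃ ψ : R →+ R, IsCartierMap p k ψ ∧ ψ (c ^ (2 * n)) = c ^ (2 * n) := by
    intro k
    induction k with
    | zero => exact ⟨_, IsCartierMap.id, rfl⟩
    | succ k ih =>
      obtain ⟨ψ, hψ, hψc⟩ := ih
      -- The factor completes `c ^ (2 * n)` to `(c ^ n) ^ p`, which `φ₀` sends to `c ^ n * c ^ n`.
      refine ⟨_, hψ.comp (hφ₀.comp_mulLeft (c ^ ((p - 2) * n))), ?_⟩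
      simp only [AddMonoidHom.comp_apply, AddMonoidHom.coe_mulLeft]
      rw [← pow_add, ← add_mul, Nat.sub_add_cancel hp, mul_comm p n, pow_mul, hφ₀p, ← pow_add,
        ← two_mul, hψc]
  refine ⟨c ^ (2 * n + 1), pow_mem hc _, fun d hd e₀ => ?_⟩
  -- Here `φ₀ (d ^ p) = d * c ^ n`; padding `c ^ n` to `c ^ (n * p ^ e)` lets `φ` release it as `c ^
  -- n`.
  have hstep : ∀ e r, r ∈ cartierImage p e d → c ^ n * r ∈ cartierImage p (e + 1) d := by
    rintro e _ ⟨φ, hφ, rfl⟩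
    refine ⟨_, (hφ.comp_mulLeft (c ^ (n * p ^ e - n))).comp (hφ₀.comp_mulLeft (d ^ (p - 1))), ?_⟩
    simp only [AddMonoidHom.comp_apply, AddMonoidHom.coe_mulLeft]
    have h1 : n ≤ n * p ^ e := Nat.le_mul_of_pos_right _ (by positivity)
    rw [← pow_succ, Nat.sub_add_cancel (by omega), hφ₀p, mul_comm d, ← mul_assoc, ← pow_add,
      Nat.sub_add_cancel h1, pow_mul, hφ]
  -- Saturating the image ideals with respect to `c` makes them an ascending chain, which
  -- stabilizes.
  let B : ℕ →o Ideal R :=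
    ⟨fun e =>
      { carrier := {r | ∃ k, c ^ k * r ∈ cartierImage p e d}
        zero_mem' := ⟨0, by simp⟩
        add_mem' := by
          rintro a b ⟨k, hk⟩ ⟨l, hl⟩
          refine ⟨k + l, ?_⟩
          have := add_mem (Ideal.mul_mem_left _ (c ^ l) hk) (Ideal.mul_mem_left _ (c ^ k) hl)
          rwa [show c ^ (k + l) * (a + b) = c ^ l * (c ^ k * a) + c ^ k * (c ^ l * b) by ring]
        smul_mem' := by
          rintro r a ⟨k, hk⟩
          exact ⟨k, by rw [smul_eq_mul, mul_left_comm]; exact Ideal.mul_mem_left _ _ hk⟩ },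
      monotone_nat_of_le_succ fun e r ⟨k, hk⟩ => ⟨n + k, by
        rw [pow_add, mul_assoc]; exact hstep _ _ hk⟩⟩
  have hB : ∀ e r, r ∈ B e ↔ ∃ k, c ^ k * r ∈ cartierImage p e d := fun _ _ => Iff.rfl
  obtain ⟨e₁, he₁⟩ := monotone_stabilizes_iff_noetherian.2 ‹IsNoetherianRing R› B
  have hle : ∀ e, B e ≤ B e₁ := fun e => by
    rcases le_total e e₁ with h | h
    · exact B.monotone h
    · exact (he₁ e h).ge
  have hpow : ∃ m, c ^ m ∈ cartierImage p e₁ d := by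
    by_contra! hno
    have hdisj : Disjoint (B e₁ : Set R) (Submonoid.powers c : Set R) := by
      rw [Set.disjoint_left]
      rintro _ ⟨k, hk⟩ ⟨m, rfl⟩
      exact hno (k + m) (by rw [pow_add]; exact hk)
    obtain ⟨P, hP, hBP, hPc⟩ := Ideal.exists_le_prime_disjoint _ _ hdisj
    have hcP : c ∉ P := fun hcP => Set.disjoint_left.1 hPc hcP (Submonoid.mem_powers c)
    have himg : ∀ e, cartierImage p e d ≤ P := fun e r hr =>
      hBP (hle e ((hB e r).2 ⟨0, by simpa using hr⟩))
    let L := Localization.AtPrime P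
    -- With all Cartier values of `d` in `P` and `c` a unit in `R_P`, `d` lies in every power of the
    -- maximal ideal. Krull's intersection theorem makes it vanish in `R_P`, impossible for a
    -- nonzerodivisor.
    have hmem : ∀ i : ℕ, algebraMap R L d ∈ IsLocalRing.maximalIdeal L ^ i := by
      intro i
      obtain ⟨N, hN⟩ := hspan i
      have h1 : c ^ N * d ∈ P ^ p ^ i := by
        refine Ideal.span_le.2 ?_ (hN d)
        rintro _ ⟨r, hr, rfl⟩
        exact Ideal.pow_mem_pow (himg i hr) _
      have h2 := Ideal.mem_map_of_mem (algebraMap R L) h1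
      rw [Ideal.map_pow, Localization.AtPrime.map_eq_maximalIdeal, map_mul] at h2
      have h3 : IsUnit (algebraMap R L (c ^ N)) :=
        IsLocalization.map_units L (⟨c ^ N, pow_mem (S := P.primeCompl) hcP N⟩ : P.primeCompl)
      exact Ideal.pow_le_pow_right (Nat.lt_pow_self (by omega)).le
        ((Ideal.unit_mul_mem_iff_mem _ h3).1 h2)
    have hLn : IsNoetherianRing L := IsLocalization.isNoetherianRing P.primeCompl L inferInstance
    have h0 : algebraMap R L d = 0 := by
      rw [← Ideal.mem_bot, ← Ideal.iInf_pow_eq_bot_of_isLocalRing (IsLocalRing.maximalIdeal L)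
        Ideal.IsPrime.ne_top', Ideal.mem_iInf]
      exact hmem
    obtain ⟨s, hs⟩ := (IsLocalization.map_eq_zero_iff P.primeCompl L d).1 h0
    exact s.2 (eq_zero_of_mul_eq_zero_of_mem_circ hd ((mul_comm _ _).trans hs) ▸ P.zero_mem)
  obtain ⟨m, φ, hφ, hφd⟩ := hpow
  -- This `k` makes the exponent at least `e₀` and gives `m ≤ p ^ k`, so `c ^ m` can be padded to `c
  -- ^ (p ^ k) * c ^ (2 * n)`. The map `ψ` sends that to `c ^ (2 * n + 1)`, independently of `d`.
  let k := e₀ + m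
  obtain ⟨ψ, hψ, hψc⟩ := hψ k
  have hk : m ≤ p ^ k + 2 * n := by
    have : k < p ^ k := Nat.lt_pow_self (by omega)
    omega
  refine ⟨k + e₁, by omega, _, (hψ.comp_mulLeft (c ^ (p ^ k + 2 * n - m))).comp hφ, ?_⟩
  simp only [AddMonoidHom.comp_apply, AddMonoidHom.coe_mulLeft]
  rw [hφd, ← pow_add, Nat.sub_add_cancel hk, pow_add, hψ, hψc, pow_succ, mul_comm]

/-- Over an F-finite reduced ring, `Ann_E (τ̃) ⊆ 0_E^*`. -/
theorem mem_tightClosureAlong_of_tauTildeAlong [IsNoetherianRing R] [IsReduced R]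
    (h : IsFFinite p R) {𝔠 : ℕ → Ideal R}
    (h𝔠 : ∀ e k, ∀ x ∈ 𝔠 e, x ^ p ^ k ∈ 𝔠 (e + k)) {z : ResidueHull R}
    (hz : ∀ r ∈ tauTildeAlong p 𝔠, r • z = 0) :
    z ∈ tightClosureAlong p 𝔠 (⊥ : Submodule R (ResidueHull R)) := by
  obtain ⟨c₀, hc₀, hc⟩ := exists_uniform_multiplier h
  refine (mem_tightClosureAlong_bot p).2 ⟨c₀, hc₀, Filter.Eventually.of_forall fun e x hx => ?_⟩
  have := finite_frobeniusTwist h e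
  refine tmul_eq_zero_of_residueHull _ _ fun l => hz _ (Submodule.mem_annihilator.2 fun y hy => ?_)
  obtain ⟨d, hd, hde⟩ := (mem_tightClosureAlong_bot p).1 hy
  obtain ⟨e₀, he₀⟩ := Filter.eventually_atTop.1 hde
  obtain ⟨k, hk, φ, hφ, hφd⟩ := hc d hd e₀
  obtain ⟨l', hl'⟩ := ((isCartierMap_of_linearMap l).comp hφ).exists_linearMap
  -- Applying `l ∘ φ` to `d * x ^ p ^ k` gives `l (x * φ d) = l (c₀ * x)`, which therefore kills
  -- `y`.
  have h1 := smul_eq_zero_of_tmul_eq_zero (he₀ (e + k) (by omega) _ (h𝔠 e k x hx)) l'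
  rw [hl', AddMonoidHom.comp_apply, mul_comm, hφ, hφd, mul_comm] at h1
  exact h1

end Cartier

/-! ### The finitistic tight closure of zero. -/

section Finitistic

variable (p : ℕ) [Fact p.Prime] {R : Type u} [CommRing R] [CharP R p]

/-- The finitistic tight closure of zero in `E`: the union of the `0_M^*` over the finitely
generated submodules `M ⊆ E`. -/
noncomputable def finitisticTightClosure (𝔠 : ℕ → Ideal R) : Submodule R (ResidueHull R) where
  carrier := {z | ∃ M : Submodule R (ResidueHull R), M.FG ∧
    ∃ w ∈ tightClosureAlong p 𝔠 (⊥ : Submodule R M), (w : ResidueHull R) = z}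
  zero_mem' := ⟨⊥, Submodule.fg_bot, 0, zero_mem _, rfl⟩
  add_mem' := by
    rintro _ _ ⟨M, hM, v, hv, rfl⟩ ⟨N, hN, w, hw, rfl⟩
    exact ⟨M ⊔ N, hM.sup hN, _,
      add_mem (map_mem_tightClosureAlong_bot p (Submodule.inclusion le_sup_left) hv)
        (map_mem_tightClosureAlong_bot p (Submodule.inclusion le_sup_right) hw), rfl⟩
  smul_mem' := by
    rintro r _ ⟨M, hM, v, hv, rfl⟩
    exact ⟨M, hM, _, Submodule.smul_mem _ r hv, rfl⟩

theorem annihilator_finitisticTightClosure_le (𝔠 : ℕ → Ideal R) :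
    (finitisticTightClosure p 𝔠).annihilator ≤ tauAlong p 𝔠 := by
  intro r hr
  rw [tauAlong, Submodule.mem_iInf]
  intro M
  rw [Submodule.mem_iInf]
  intro hM
  exact Submodule.mem_annihilator.2 fun w hw =>
    Subtype.ext (Submodule.mem_annihilator.1 hr w ⟨M, hM, w, hw, rfl⟩)

/-- If `I z` lies in the finitistic tight closure, this is witnessed by a single finitely generated
submodule containing `z`. -/
theorem exists_fg_of_smul_mem_finitistic {𝔠 : ℕ → Ideal R} {I : Ideal R} (hI : I.FG)
    {z : ResidueHull R} (hz : ∀ i ∈ I, i • z ∈ finitisticTightClosure p 𝔠) :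
    ∃ M : Submodule R (ResidueHull R), M.FG ∧ ∃ hzM : z ∈ M,
      ∀ i ∈ I, i • (⟨z, hzM⟩ : M) ∈ tightClosureAlong p 𝔠 (⊥ : Submodule R M) := by
  classical
  obtain ⟨S, rfl⟩ := hI
  have h1 : ∀ i ∈ S, ∃ M : Submodule R (ResidueHull R), M.FG ∧
    ∃ w ∈ tightClosureAlong p 𝔠 (⊥ : Submodule R M), (w : ResidueHull R) = i • z :=
      fun i hi => hz i (Ideal.subset_span hi)
  choose! N hN hw using h1
  have hzM : z ∈ Submodule.span R {z} ⊔ ⨆ i ∈ S, N i :=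
    Submodule.mem_sup_left (Submodule.mem_span_singleton_self z)
  refine ⟨Submodule.span R {z} ⊔ ⨆ i ∈ S, N i,
    (Submodule.fg_span_singleton z).sup (Submodule.fg_biSup S N hN), hzM, fun i hi => ?_⟩
  induction hi using Submodule.span_induction with
  | mem i hi =>
    obtain ⟨w, hw, hwz⟩ := hw i hi
    have hle : N i ≤ Submodule.span R {z} ⊔ ⨆ i ∈ S, N i :=
      (le_biSup N hi).trans le_sup_right
    convert map_mem_tightClosureAlong_bot p (Submodule.inclusion hle) hw using 1
    exact Subtype.ext hwz.symm
  | zero => rw [zero_smul]; exact zero_mem _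
  | add a b _ _ ha hb => rw [add_smul]; exact add_mem ha hb
  | smul r a _ ha => rw [smul_assoc]; exact Submodule.smul_mem _ _ ha

end Finitistic

end TestIdeal

/-! ### The two inclusions. -/

theorem proposition2p2 (p : ℕ) [Fact p.Prime] (R : Type u) [CommRing R] [IsNoetherianRing R]
    [IsReduced R] [CharP R p] :
    (TestIdeal.IsFFinite p R →
      ∀ 𝔞 𝔟 : Ideal R, TestIdeal.MeetsCirc 𝔞 → TestIdeal.MeetsCirc 𝔟 →
      ∀ t s : ℝ, 0 < t → 0 < s →
        TestIdeal.idealTightClosure p (TestIdeal.tauTilde p 𝔞 t) 𝔞 t *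
            TestIdeal.tauTildeMul p 𝔞 t 𝔟 s ≤
          TestIdeal.tauTilde p 𝔞 t * TestIdeal.tauTilde p 𝔟 s) ∧
    (∀ [IsLocalRing R] [IsAdicComplete (IsLocalRing.maximalIdeal R) R],
      ∀ 𝔞 𝔟 : Ideal R, 0 < 𝔞.height → 0 < 𝔟.height →
      ∀ t s : ℝ, 0 < t → 0 < s →
        TestIdeal.idealTightClosure p (TestIdeal.tau p 𝔞 t) 𝔞 t *
            TestIdeal.tauMul p 𝔞 t 𝔟 s ≤
          TestIdeal.tau p 𝔞 t * TestIdeal.tau p 𝔟 s) := by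
  refine ⟨fun hF 𝔞 𝔟 _ _ t s _ _ => Ideal.mul_le.2 fun y hy r hr => ?_,
    fun 𝔞 𝔟 _ _ t s _ _ => Ideal.mul_le.2 fun y hy r hr => ?_⟩
  · refine TestIdeal.mem_of_forall_residueHull _ _ fun z hz => ?_
    have h1 := TestIdeal.smul_mem_tightClosureAlong_bot_mul p (IsNoetherian.noetherian _) hy
      (z := z) (𝔟 := TestIdeal.realPower p 𝔟 s) fun i hi =>
        TestIdeal.mem_tightClosureAlong_of_tauTildeAlong hF
          (TestIdeal.pow_mem_realPower 𝔟 s) fun j hj => by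
            rw [smul_smul, mul_comm]
            exact hz _ (Ideal.mul_mem_mul hi hj)
    rw [mul_comm, mul_smul]
    exact Submodule.mem_annihilator.1 hr _ h1
  · refine TestIdeal.mem_of_forall_residueHull _ _ fun z hz => ?_
    -- The multiplication argument needs all `i z` in the tight closure of zero of one finitely
    -- generated `M` that also contains `z`.
    obtain ⟨M, hM, hzM, hI⟩ := TestIdeal.exists_fg_of_smul_mem_finitistic p
      (𝔠 := TestIdeal.realPower p 𝔟 s)
      (IsNoetherian.noetherian (TestIdeal.tau p 𝔞 t)) (z := z) fun i hi =>
        TestIdeal.mem_of_annihilator_residueHull _ fun j hj => by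
          rw [smul_smul, mul_comm]
          exact hz _ (Ideal.mul_mem_mul hi
            (TestIdeal.annihilator_finitisticTightClosure_le p _ hj))
    have h1 := TestIdeal.smul_mem_tightClosureAlong_bot_mul p (IsNoetherian.noetherian _) hy hI
    have h2 : r ∈ (TestIdeal.tightClosureAlong p (TestIdeal.realPowerMul p 𝔞 t 𝔟 s)
        (⊥ : Submodule R M)).annihilator :=
      (Submodule.mem_iInf _).1 ((Submodule.mem_iInf _).1 hr M) hM
    rw [mul_comm, mul_smul]
    exact congrArg Subtype.val (Submodule.mem_annihilator.1 h2 _ h1)
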